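/- Let $k$ be a field, $\bar k$ an algebraic closure of $k$, $n\in\mathbb N$, $A=k[x_1,\dots,x_n]$ the polynomial ring in $n$ indeterminates, and $\mathfrak p$ a prime ideal of $A$ with residue field $k(\mathfrak p)=A_{\mathfrak p}/\mathfrak pA_{\mathfrak p}$. Let $\operatorname{Specm}_{\mathrm{sep}}(A)$ be the set of maximal ideals $\mathfrak m$ of $A$ such that $k(\mathfrak m)/k$ is a separable algebraic extension, and let $V(\mathfrak p)\subseteq\operatorname{Spec}(A)$ be the set of prime ideals containing $\mathfrak p$, with the Zariski topology. The following statements are equivalent: 1. $k(\mathfrak p)$ is formally smooth over $k$. 2. There exist $r\in\mathbb N$ (possibly $r=0$, the empty determinant being $1$), $k$-derivations $d_1,\dots,d_r\in\operatorname{Der}_k(A,A)$ and elements $g_1,\dots,g_r\in A$ such that $\mathfrak pA_{\mathfrak p}=\langle \frac{g_1}{1},\dots,\frac{g_r}{1}\rangle$ and $\det\big((d_i(g_j))_{1\le i,j\le r}\big)\notin\mathfrak p$. 3. $k(\mathfrak p)$ is separably generated over $k$, i.e. there is a transcendence basis $T$ of $k(\mathfrak p)/k$ such that $k(\mathfrak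 p)$ is a separable algebraic extension of $k(T)$. 4. $k(\mathfrak p)\otimes_k\bar k$ is reduced. 5. $\operatorname{Specm}_{\mathrm{sep}}(A)\cap V(\mathfrak p)$ is dense in $V(\mathfrak p)$. 6. $\mathfrak p=\bigcap_{\mathfrak m\in\operatorname{Specm}_{\mathrm{sep}}(A)\cap V(\mathfrak p)}\mathfrak m$, where an empty intersection is $A$. -/

import Mathlib

open scoped TensorProduct

/-- A field extension `K / k` is separably generated if `K` has a transcendence basis `T` over `k`
such that `K` is a separable algebraic extension of `k(T)`. -/
def SeparablyGenerated (k K : Type*) [Field k] [Field K] [Algebra k K] : Prop :=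
  ∃ T : Set K, IsTranscendenceBasis k ((↑) : T → K) ∧
    Algebra.IsSeparable (IntermediateField.adjoin k T) K

/-- The maximal separable spectrum of a `k`-algebra `B`: the maximal ideals of `B` whose residue
field is a separable algebraic extension of `k`, viewed as a subset of `Spec B`. -/
def specmSep (k B : Type*) [Field k] [CommRing B] [Algebra k B] : Set (PrimeSpectrum B) :=
  {m | m.asIdeal.IsMaximal ∧ Algebra.IsSeparable k m.asIdeal.ResidueField}

/-! The core is the cycle 1 → 6 → 4 → 3 → 1. If `k(p)` is formally smooth, `A/p` is smooth at its
generic point, hence étale over an affine space on a nonempty open set. Étale maps are open and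
affine space has many separable points, so these lift to separable points of `A/p` avoiding any
given nonzero element. Conversely, enough such points embed `A/p` in a product of separable
extensions of `k`, which forces `k(p) ⊗ k̄` to be reduced; Mac Lane's criterion then gives a
separating transcendence basis. Statement 2 is the Jacobian criterion: since `A_p` is formally
smooth, 1 means that `d : m/m² → k(p) ⊗ Ω` is injective. -/

theorem SeparablyGenerated.formallySmooth {k K : Type*} [Field k] [Field K] [Algebra k K]
    (h : SeparablyGenerated k K) : Algebra.FormallySmooth k K := by
  obtain ⟨T, hT, hsep⟩ := h
  have : Algebra.IsSeparable (IntermediateField.adjoin k (Set.range ((↑) : T → K))) K := by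
    rwa [Subtype.range_coe]
  exact .of_algebraicIndependent_of_isSeparable hT.1

/-! ### Mac Lane's criterion -/

/-- If `K ⊗ k̄` is reduced, then `p`-th powers of linearly independent families stay linearly
independent, `p` being the characteristic. -/
theorem LinearIndependent.pow_of_isReduced_tensorProduct {k K kbar ι : Type*} [Field k] [Field K]
    [Algebra k K] [Field kbar] [Algebra k kbar] [IsAlgClosed kbar] [IsReduced (K ⊗[k] kbar)]
    (p : ℕ) [hp : Fact p.Prime] [CharP k p] {v : ι → K} (hv : LinearIndependent k v) :
    LinearIndependent k (fun i => v i ^ p) := by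
  have : CharP kbar p := charP_of_injective_algebraMap (algebraMap k kbar).injective p
  have : CharP (K ⊗[k] kbar) p :=
    charP_of_injective_algebraMap (algebraMap k (K ⊗[k] kbar)).injective p
  rw [linearIndependent_iff']
  intro s c hc i hi
  choose r hr using fun i => IsAlgClosed.exists_pow_nat_eq (algebraMap k kbar (c i)) hp.1.pos
  have hz : (∑ i ∈ s, v i ⊗ₜ[k] r i) = 0 := by
    -- As `r i ^ p = c i`, Frobenius sends this sum to `(∑ c i • v i ^ p) ⊗ 1 = 0`.
    refine eq_zero_of_pow_eq_zero (n := p) ?_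
    rw [sum_pow_char]
    simp only [Algebra.TensorProduct.tmul_pow, hr, Algebra.algebraMap_eq_smul_one,
      TensorProduct.tmul_smul, TensorProduct.smul_tmul']
    rw [← TensorProduct.sum_tmul, hc, TensorProduct.zero_tmul]
  have hz' : (∑ i ∈ s, r i • ((1 : kbar) ⊗ₜ[k] v i)) = 0 := by
    simpa [TensorProduct.smul_tmul'] using congr(TensorProduct.comm k K kbar $hz)
  have hri : r i = 0 :=
    linearIndependent_iff'.1 (Module.Flat.linearIndependent_one_tmul (S := kbar) hv) s r hz' i hi
  simpa [hri, hp.1.ne_zero] using (hr i).symm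

theorem separablyGenerated_of_isReduced_tensorProduct {k K : Type*} (kbar : Type*) [Field k]
    [Field K] [Algebra k K] [Algebra.EssFiniteType k K] [Field kbar] [Algebra k kbar]
    [IsAlgClosed kbar] [IsReduced (K ⊗[k] kbar)] : SeparablyGenerated k K := by
  obtain _ | ⟨p, hp, hpk⟩ := CharP.exists' k
  · obtain ⟨s, hs, hs'⟩ := exists_isTranscendenceBasis_and_isSeparable_of_perfectField k K
    exact ⟨s, hs, hs'⟩
  · obtain ⟨s, hs, hs'⟩ :=
      exists_isTranscendenceBasis_and_isSeparable_of_linearIndepOn_pow_of_essFiniteType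
        (k := k) (K := K) p hp.1 fun s hs =>
          LinearIndependent.pow_of_isReduced_tensorProduct (kbar := kbar) p hs
    exact ⟨s, hs, hs'⟩

/-! ### Reducedness and density from separable points -/

theorem isReduced_tensorProduct_of_isSeparable (k K L : Type*) [Field k] [Field K] [Field L]
    [Algebra k K] [Algebra k L] [Algebra.EssFiniteType k K] [Algebra.IsSeparable k K] :
    IsReduced (K ⊗[k] L) := by
  have := Algebra.FormallyUnramified.of_isSeparable k K
  have : IsReduced (L ⊗[k] K) := Algebra.FormallyUnramified.isReduced_of_field L (L ⊗[k] K)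
  exact isReduced_of_injective (Algebra.TensorProduct.comm k K L)
    (Algebra.TensorProduct.comm k K L).injective

theorem isReduced_residueField_tensorProduct {k A ι : Type*} (L : Type*) [Field k] [CommRing A]
    [Algebra k A] [Algebra.EssFiniteType k A] [Field L] [Algebra k L] (p : Ideal A) [p.IsPrime]
    (m : ι → Ideal A) [∀ i, (m i).IsPrime] [∀ i, Algebra.IsSeparable k (m i).ResidueField]
    (hp : p = ⨅ i, m i) : IsReduced (p.ResidueField ⊗[k] L) := by
  have : IsReduced ((A ⧸ p) ⊗[k] L) := by
    let f (i : ι) : (A ⧸ p) →ₐ[k] (m i).ResidueField :=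
      Ideal.Quotient.liftₐ p (IsScalarTower.toAlgHom k A _) fun a ha => by
        simpa using (hp ▸ iInf_le m i : p ≤ m i) ha
    have hf (x : A ⧸ p) (hx : ∀ i, f i x = 0) : x = 0 := by
      obtain ⟨a, rfl⟩ := Ideal.Quotient.mk_surjective x
      refine Ideal.Quotient.eq_zero_iff_mem.2 ?_
      rw [hp, Ideal.mem_iInf]
      exact fun i => by simpa [f] using hx i
    have (i : ι) : Algebra.EssFiniteType k (m i).ResidueField := .comp k A _
    have (i : ι) := isReduced_tensorProduct_of_isSeparable k (m i).ResidueField L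
    refine ⟨fun x hx => ?_⟩
    -- Tensoring need not commute with infinite products; coordinates in a `k`-basis of `L` reduce
    -- vanishing to `A ⧸ p`, where the `f i` are jointly injective.
    let b := Module.Basis.ofVectorSpace k L
    apply (b.baseChange (A ⧸ p)).repr.injective
    ext j
    refine hf _ fun i => ?_
    have h0 : Algebra.TensorProduct.map (f i) (AlgHom.id k L) x = 0 :=
      (hx.map (Algebra.TensorProduct.map (f i) (AlgHom.id k L))).eq_zero
    have key (y : (A ⧸ p) ⊗[k] L) : f i ((b.baseChange (A ⧸ p)).repr y j) =
        (b.baseChange (m i).ResidueField).repr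
          (Algebra.TensorProduct.map (f i) (AlgHom.id k L) y) j := by
      induction y with
      | zero => simp
      | tmul a l => simp
      | add y z hy hz => simp [hy, hz]
    simpa [h0] using key x
  have : IsReduced (p.ResidueField ⊗[A ⧸ p] ((A ⧸ p) ⊗[k] L)) := by
    let : Algebra ((A ⧸ p) ⊗[k] L) (p.ResidueField ⊗[A ⧸ p] ((A ⧸ p) ⊗[k] L)) :=
      Algebra.TensorProduct.rightAlgebra
    exact isReduced_localizationPreserves
      (Algebra.algebraMapSubmonoid ((A ⧸ p) ⊗[k] L) (nonZeroDivisors (A ⧸ p)))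
      (p.ResidueField ⊗[A ⧸ p] ((A ⧸ p) ⊗[k] L)) ‹_›
  let e := (Algebra.TensorProduct.cancelBaseChange k (A ⧸ p) p.ResidueField p.ResidueField L).symm
  exact isReduced_of_injective e e.injective

theorem dense_iff_eq_iInf {A : Type*} [CommRing A] (p : Ideal A) [p.IsPrime]
    (S : Set (PrimeSpectrum A)) :
    Dense {x : PrimeSpectrum.zeroLocus (p : Set A) | (x : PrimeSpectrum A) ∈ S} ↔
      p = ⨅ m ∈ S ∩ PrimeSpectrum.zeroLocus (p : Set A), m.asIdeal := by
  have hle : p ≤ ⨅ m ∈ S ∩ PrimeSpectrum.zeroLocus (p : Set A), m.asIdeal :=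
    le_iInf₂ fun m hm => hm.2
  have himg : ((↑) : PrimeSpectrum.zeroLocus (p : Set A) → PrimeSpectrum A) ''
      {x | (x : PrimeSpectrum A) ∈ S} = S ∩ PrimeSpectrum.zeroLocus (p : Set A) := by
    ext x; simp [and_comm]
  rw [Subtype.dense_iff, himg, ← PrimeSpectrum.zeroLocus_vanishingIdeal_eq_closure,
    PrimeSpectrum.zeroLocus_subset_zeroLocus_iff, PrimeSpectrum.vanishingIdeal,
    Ideal.IsPrime.radical ‹_›, hle.ge_iff_eq]

/-! ### The Jacobian criterion -/

open KaehlerDifferential IsLocalRing in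
/-- The residue field of a formally smooth local algebra over a field is formally smooth iff
`d` induces an injection on the cotangent space. -/
theorem formallySmooth_residueField_iff {k R : Type*} [Field k] [CommRing R] [IsLocalRing R]
    [Algebra k R] [Algebra.FormallySmooth k R] :
    Algebra.FormallySmooth k (ResidueField R) ↔
      ∀ x ∈ maximalIdeal R, (1 : ResidueField R) ⊗ₜ[R] D k R x = 0 → x ∈ maximalIdeal R ^ 2 := by
  rw [Algebra.formallySmooth_iff, and_iff_right (Module.Projective.of_free),
    ← Algebra.FormallySmooth.kerCotangentToTensor_injective_iff (P := R) residue_surjective,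
    injective_iff_map_eq_zero]
  have hker : RingHom.ker (algebraMap R (ResidueField R)) = maximalIdeal R := ker_residue
  rw [(Ideal.toCotangent_surjective _).forall]
  simp only [kerCotangentToTensor_toCotangent, Ideal.toCotangent_eq_zero, Subtype.forall, hker]

-- Each `d i` induces a functional `δ i` on `k(p) ⊗ Ω`. If `∑ a j * g j` has zero differential, the
-- `δ i` show that the invertible matrix `(d i (g j))` over `k(p)` kills the residues of the `a j`;
-- so every `a j` lies in `m`.
open IsLocalRing in
theorem formallySmooth_residueField_of_det_notMem {k A : Type*} [Field k] [CommRing A] [Algebra k A]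
    [Algebra.FormallySmooth k A] (p : Ideal A) [p.IsPrime] {r : ℕ} (d : Fin r → Derivation k A A)
    (g : Fin r → A)
    (hg : p.map (algebraMap A (Localization.AtPrime p)) =
      Ideal.span (Set.range fun i => algebraMap A (Localization.AtPrime p) (g i)))
    (hdet : (Matrix.of fun i j => d i (g j)).det ∉ p) :
    Algebra.FormallySmooth k p.ResidueField := by
  have : Algebra.FormallySmooth A (Localization.AtPrime p) := .of_isLocalization p.primeCompl
  have : Algebra.FormallyEtale A (Localization.AtPrime p) := .of_isLocalization p.primeCompl
  have : Algebra.FormallySmooth k (Localization.AtPrime p) := .comp k A (Localization.AtPrime p)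
  rw [Localization.AtPrime.map_eq_maximalIdeal] at hg
  refine formallySmooth_residueField_iff.2 fun x hx hdx => ?_
  have hgm (j) : algebraMap A (Localization.AtPrime p) (g j) ∈ maximalIdeal (Localization.AtPrime p) :=
    hg ▸ Ideal.subset_span ⟨j, rfl⟩
  obtain ⟨a, rfl⟩ := (Ideal.mem_span_range_iff_exists_fun).1 (hg ▸ hx)
  let δ (i : Fin r) : p.ResidueField ⊗[Localization.AtPrime p] Ω[Localization.AtPrime p⁄k]
      →ₗ[p.ResidueField] p.ResidueField :=
    LinearMap.liftBaseChange _ ((Algebra.linearMap (Localization.AtPrime p) p.ResidueField) ∘ₗ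
      (LinearMap.liftBaseChange (Localization.AtPrime p)
        ((Algebra.linearMap A (Localization.AtPrime p)) ∘ₗ (d i).liftKaehlerDifferential)) ∘ₗ
      (KaehlerDifferential.tensorKaehlerEquivOfFormallyEtale k A
        (Localization.AtPrime p)).symm.toLinearMap)
  have hδ (i j) (c : Localization.AtPrime p) :
      δ i (1 ⊗ₜ KaehlerDifferential.D k (Localization.AtPrime p)
        (c * algebraMap A (Localization.AtPrime p) (g j))) =
      residue (Localization.AtPrime p) c * algebraMap A _ (d i (g j)) := by
    have := (residue_eq_zero_iff _).2 (hgm j)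
    have h0 : algebraMap A (Localization.AtPrime p) (g j) • (1 : p.ResidueField) = 0 := by
      rw [Algebra.smul_def, ResidueField.algebraMap_eq, this, zero_mul]
    rw [Derivation.leibniz, TensorProduct.tmul_add, ← TensorProduct.smul_tmul c,
      ← TensorProduct.smul_tmul (algebraMap A _ (g j)), h0, TensorProduct.zero_tmul, add_zero]
    simp [δ, KaehlerDifferential.tensorKaehlerEquivOfFormallyEtale_symm_D_algebraMap,
      Algebra.smul_def, IsScalarTower.algebraMap_apply A (Localization.AtPrime p) p.ResidueField]
  have ha : Matrix.mulVec ((Matrix.of fun i j => d i (g j)).map (algebraMap A p.ResidueField))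
      (fun j => residue (Localization.AtPrime p) (a j)) = 0 := by
    ext i
    have := congr(δ i $hdx)
    simp only [map_sum, TensorProduct.tmul_sum, hδ, map_zero] at this
    simpa [Matrix.mulVec, dotProduct, mul_comm] using this
  have ha0 := Matrix.eq_zero_of_mulVec_eq_zero (by
    rw [← RingHom.mapMatrix_apply, ← RingHom.map_det]
    simpa using hdet) ha
  rw [pow_two]
  exact Ideal.sum_mem _ fun j _ => Ideal.mul_mem_mul
    ((residue_eq_zero_iff _).1 (congr_fun ha0 j)) (hgm j)

theorem exists_det_submatrix_ne_zero {K : Type*} [Field K] {m n : Type*} [Fintype m] [Fintype n]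
    [DecidableEq n] (M : Matrix m n K) (hM : LinearIndependent K M.col) :
    ∃ f : n → m, (M.submatrix f id).det ≠ 0 := by
  obtain ⟨κ, a, ha, hspan, hli⟩ := exists_linearIndependent' K M.row
  have := Fintype.ofInjective a ha
  have hcard : Fintype.card n = Fintype.card κ := by
    rw [linearIndependent_iff_card_eq_finrank_span.1 hM,
      linearIndependent_iff_card_eq_finrank_span.1 hli, Set.finrank, Set.finrank, hspan,
      ← Matrix.rank_eq_finrank_span_row, Matrix.rank_eq_finrank_span_cols]
  let e := Fintype.equivOfCardEq hcard
  refine ⟨a ∘ e, IsUnit.ne_zero ((Matrix.isUnit_iff_isUnit_det _).1 ?_)⟩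
  exact Matrix.linearIndependent_rows_iff_isUnit.1 (hli.comp e e.injective)

-- The images of elements of `p` span `m/m²`, so a basis can be chosen among them. Nakayama makes it
-- generate `m`; its independence is the last clause.
open IsLocalRing in
theorem exists_generators_cotangent {A : Type*} [CommRing A] [IsNoetherianRing A]
    (p : Ideal A) [p.IsPrime] :
    ∃ (r : ℕ) (g : Fin r → A),
      p.map (algebraMap A (Localization.AtPrime p)) =
        Ideal.span (Set.range fun i => algebraMap A (Localization.AtPrime p) (g i)) ∧
      ∀ a : Fin r → Localization.AtPrime p,
        ∑ j, a j * algebraMap A _ (g j) ∈ maximalIdeal (Localization.AtPrime p) ^ 2 →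
        ∀ j, a j ∈ maximalIdeal (Localization.AtPrime p) := by
  let R := Localization.AtPrime p
  let ψ (x : p) : maximalIdeal R := ⟨algebraMap A R x,
    (IsLocalization.AtPrime.to_map_mem_maximal_iff R p _).2 x.2⟩
  have hspan : Submodule.span (ResidueField R)
      (Set.range fun x => (maximalIdeal R).toCotangent (ψ x)) = ⊤ := by
    rw [Set.range_comp' (maximalIdeal R).toCotangent, CotangentSpace.span_image_eq_top_iff]
    apply Submodule.map_injective_of_injective (maximalIdeal R).injective_subtype
    rw [Submodule.map_span, Submodule.map_top, Submodule.range_subtype, ← Set.range_comp]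
    refine .trans ?_ (Localization.AtPrime.map_eq_maximalIdeal (I := p))
    rw [Ideal.map, Ideal.span, Set.image_eq_range]
    rfl
  obtain ⟨κ, a, -, hspan', hli⟩ := exists_linearIndependent' (ResidueField R) fun x =>
    (maximalIdeal R).toCotangent (ψ x)
  have := hli.finite
  have := Fintype.ofFinite κ
  let e := (Fintype.equivFin κ).symm
  refine ⟨Fintype.card κ, fun i => a (e i), ?_, fun c hc j => ?_⟩
  · rw [hspan, Function.comp_def, Set.range_comp' (maximalIdeal R).toCotangent,
      CotangentSpace.span_image_eq_top_iff] at hspan'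
    have := congr(Submodule.map (maximalIdeal R).subtype $hspan')
    rw [Submodule.map_span, Submodule.map_top, Submodule.range_subtype, ← Set.range_comp,
      ← (e.surjective.range_comp _)] at this
    exact (Localization.AtPrime.map_eq_maximalIdeal (I := p)).trans this.symm
  · have := Fintype.linearIndependent_iff.1 (hli.comp e e.injective) (fun i => residue R (c i)) ?_ j
    · rwa [residue_eq_zero_iff] at this
    · have h0 : (maximalIdeal R).toCotangent (∑ j, c j • ψ (a (e j))) = 0 := by
        rw [Ideal.toCotangent_eq_zero]
        simpa [ψ] using hc
      rw [map_sum] at h0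
      simp only [map_smul] at h0
      exact h0

open KaehlerDifferential in
theorem one_tmul_D_mul_algebraMap_mvPolynomial {k σ R K : Type*} [Field k] [Fintype σ] [CommRing R]
    [Algebra k R] [Algebra (MvPolynomial σ k) R] [IsScalarTower k (MvPolynomial σ k) R]
    [CommRing K] [Algebra R K] (a : R) (g : MvPolynomial σ k)
    (hg : algebraMap R K (algebraMap _ R g) = 0) :
    (1 : K) ⊗ₜ[R] D k R (a * algebraMap _ R g) =
      ∑ i, algebraMap R K (a * algebraMap _ R (MvPolynomial.pderiv i g)) ⊗ₜ
        D k R (algebraMap (MvPolynomial σ k) R (MvPolynomial.X i)) := by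
  have hD : D k R (algebraMap _ R g) = ∑ i, algebraMap _ R (MvPolynomial.pderiv i g) •
      D k R (algebraMap (MvPolynomial σ k) R (MvPolynomial.X i)) := by
    have := (mvPolynomialBasis k σ).sum_repr (D k _ g)
    simpa using congr(KaehlerDifferential.map k k _ R $this.symm)
  have h0 : algebraMap _ R g • (1 : K) = 0 := by rw [Algebra.smul_def, hg, zero_mul]
  rw [Derivation.leibniz, TensorProduct.tmul_add, ← TensorProduct.smul_tmul (algebraMap _ R g), h0,
    TensorProduct.zero_tmul, add_zero, hD, Finset.smul_sum, TensorProduct.tmul_sum]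
  refine Finset.sum_congr rfl fun i _ => ?_
  rw [smul_smul, ← TensorProduct.smul_tmul, Algebra.smul_def, mul_one]

theorem exists_det_notMem_of_formallySmooth {k : Type*} [Field k] {n : ℕ}
    (p : Ideal (MvPolynomial (Fin n) k)) [p.IsPrime]
    [Algebra.FormallySmooth k p.ResidueField] :
    ∃ (r : ℕ) (d : Fin r → Derivation k (MvPolynomial (Fin n) k) (MvPolynomial (Fin n) k))
        (g : Fin r → MvPolynomial (Fin n) k),
        p.map (algebraMap (MvPolynomial (Fin n) k) (Localization.AtPrime p)) =
          Ideal.span (Set.range fun i =>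
            algebraMap (MvPolynomial (Fin n) k) (Localization.AtPrime p) (g i)) ∧
        (Matrix.of fun i j => d i (g j)).det ∉ p := by
  obtain ⟨r, g, hg, hli⟩ := exists_generators_cotangent p
  have : Algebra.FormallySmooth (MvPolynomial (Fin n) k) (Localization.AtPrime p) :=
    .of_isLocalization p.primeCompl
  have : Algebra.FormallySmooth k (Localization.AtPrime p) :=
    .comp k (MvPolynomial (Fin n) k) _
  have hgm (j) : algebraMap _ (Localization.AtPrime p) (g j) ∈
      IsLocalRing.maximalIdeal (Localization.AtPrime p) := by
    rw [← Localization.AtPrime.map_eq_maximalIdeal, hg]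
    exact Ideal.subset_span ⟨j, rfl⟩
  let M : Matrix (Fin n) (Fin r) p.ResidueField :=
    Matrix.of fun i j => algebraMap _ _ (MvPolynomial.pderiv i (g j))
  -- A relation among the columns of the Jacobian matrix lifts to `∑ a j * g j` with zero
  -- differential, hence in `m²`, so its coefficients vanish in `k(p)`.
  obtain ⟨f, hf⟩ := exists_det_submatrix_ne_zero M (by
    rw [Fintype.linearIndependent_iff]
    intro c hc j
    choose a ha using fun j => IsLocalRing.residue_surjective (c j)
    rw [← ha, IsLocalRing.residue_eq_zero_iff]
    refine hli a (formallySmooth_residueField_iff.1 ‹_› _ (Ideal.sum_mem _ fun j _ =>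
      Ideal.mul_mem_left _ _ (hgm j)) ?_) j
    have hgm' (j) := (IsLocalRing.residue_eq_zero_iff _).2 (hgm j)
    rw [map_sum, TensorProduct.tmul_sum, Finset.sum_congr rfl fun j _ =>
      one_tmul_D_mul_algebraMap_mvPolynomial (K := p.ResidueField) (a j) (g j) (hgm' j)]
    rw [Finset.sum_comm]
    simp only [← TensorProduct.sum_tmul]
    refine Finset.sum_eq_zero fun i _ => ?_
    have : ∑ j, algebraMap _ p.ResidueField
        (a j * algebraMap _ (Localization.AtPrime p) (MvPolynomial.pderiv i (g j))) = 0 := by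
      simpa [M, ← ha, IsScalarTower.algebraMap_apply (MvPolynomial (Fin n) k)
        (Localization.AtPrime p) p.ResidueField] using congr_fun hc i
    rw [this, TensorProduct.zero_tmul])
  refine ⟨r, fun i => MvPolynomial.pderiv (f i), g, hg, fun h => hf ?_⟩
  rw [← Ideal.algebraMap_residueField_eq_zero, RingHom.map_det] at h
  exact h

/-! ### Existence of separable points -/

theorem ker_mem_specmSep {k A L : Type*} [Field k] [CommRing A] [Algebra k A] [Field L]
    [Algebra k L] [Algebra.IsSeparable k L] (f : A →ₐ[k] L) :
    ⟨RingHom.ker f, RingHom.ker_isPrime f⟩ ∈ specmSep k A := by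
  have : (RingHom.ker f).IsPrime := RingHom.ker_isPrime f
  have hmax : (RingHom.ker f).IsMaximal := by
    have := Algebra.IsIntegral.of_injective (Ideal.kerLiftAlg f) (Ideal.kerLiftAlg_injective f)
    exact Ideal.Quotient.maximal_of_isField _
      (isField_of_isIntegral_of_isField' (R := k) (Field.toIsField k))
  refine ⟨hmax, ?_⟩
  exact Algebra.IsSeparable.of_algHom k L (Ideal.ResidueField.liftₐ (RingHom.ker f) f le_rfl
    fun x hx => IsUnit.mk0 _ hx)

theorem exists_mem_specmSep_notMem_mvPolynomial {k : Type*} [Field k] {n : ℕ}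
    {h : MvPolynomial (Fin n) k} (hh : h ≠ 0) :
    ∃ m ∈ specmSep k (MvPolynomial (Fin n) k), h ∉ m.asIdeal := by
  let L := SeparableClosure k
  -- This is why points are taken over the separable closure: `k` itself may be finite.
  have : Infinite L := by
    by_contra H
    have : Finite L := not_infinite_iff_finite.1 H
    exact H inferInstance
  obtain ⟨x, hx⟩ : ∃ x : Fin n → L, MvPolynomial.aeval x h ≠ 0 := by
    by_contra! H
    refine hh (MvPolynomial.map_injective _ (algebraMap k L).injective
      (MvPolynomial.funext fun x => ?_))
    simpa [MvPolynomial.eval_map, MvPolynomial.aeval_def] using H x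
  exact ⟨_, ker_mem_specmSep (MvPolynomial.aeval x), hx⟩

/-- An étale algebra over a polynomial ring in which `b` is not nilpotent has a prime avoiding
`b` with residue field separable algebraic over `k`. -/
theorem exists_mem_specmSep_of_etale {k B : Type*} [Field k] [CommRing B] [Algebra k B] {n : ℕ}
    [Algebra (MvPolynomial (Fin n) k) B] [IsScalarTower k (MvPolynomial (Fin n) k) B]
    [Algebra.Etale (MvPolynomial (Fin n) k) B] (b : B) (hb : ¬ IsNilpotent b) :
    ∃ q : PrimeSpectrum B, b ∉ q.asIdeal ∧ Algebra.IsSeparable k q.asIdeal.ResidueField := by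
  let A := MvPolynomial (Fin n) k
  obtain ⟨h, hh, hU⟩ : ∃ h : A, h ≠ 0 ∧ (PrimeSpectrum.basicOpen h : Set (PrimeSpectrum A)) ⊆
      PrimeSpectrum.comap (algebraMap A B) '' (PrimeSpectrum.basicOpen b) := by
    have hopen : IsOpen (PrimeSpectrum.comap (algebraMap A B) '' (PrimeSpectrum.basicOpen b)) :=
      PrimeSpectrum.isOpenMap_comap_of_hasGoingDown_of_finitePresentation _
        (PrimeSpectrum.basicOpen b).2
    obtain ⟨q, hq⟩ : ∃ q : PrimeSpectrum B, q ∈ PrimeSpectrum.basicOpen b := by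
      by_contra! H
      exact hb (PrimeSpectrum.basicOpen_eq_bot_iff b |>.1 (by ext q; simpa using H q))
    obtain ⟨_, ⟨_, ⟨h, rfl⟩, rfl⟩, hxf, hf⟩ :=
      PrimeSpectrum.isBasis_basic_opens.exists_subset_of_mem_open (Set.mem_image_of_mem _ hq) hopen
    refine ⟨h, ?_, hf⟩
    rintro rfl
    simp at hxf
  obtain ⟨m, hm, hhm⟩ := exists_mem_specmSep_notMem_mvPolynomial hh
  obtain ⟨q, hq, rfl⟩ := hU hhm
  refine ⟨q, hq, ?_⟩
  have : q.asIdeal.LiesOver (PrimeSpectrum.comap (algebraMap A B) q).asIdeal := ⟨rfl⟩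
  have := hm.2
  let := Localization.AtPrime.algebraOfLiesOver
    (PrimeSpectrum.comap (algebraMap A B) q).asIdeal q.asIdeal
  -- Étale algebras have separable residue field extensions.
  have : Algebra.IsSeparable (PrimeSpectrum.comap (algebraMap A B) q).asIdeal.ResidueField
    q.asIdeal.ResidueField := inferInstance
  exact Algebra.IsSeparable.trans k
    (PrimeSpectrum.comap (algebraMap A B) q).asIdeal.ResidueField _

theorem exists_mem_specmSep_notMem {k A : Type*} [Field k] [CommRing A] [Algebra k A]
    [Algebra.FiniteType k A] (p : Ideal A) [p.IsPrime] [Algebra.FormallySmooth k p.ResidueField]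
    {a : A} (ha : a ∉ p) : ∃ m ∈ specmSep k A, p ≤ m.asIdeal ∧ a ∉ m.asIdeal := by
  let B := A ⧸ p
  have : IsNoetherianRing A := Algebra.FiniteType.isNoetherianRing k A
  have : Algebra.FinitePresentation k B := Algebra.FinitePresentation.of_finiteType.1 inferInstance
  have : IsFractionRing B (Localization.AtPrime (⊥ : Ideal B)) := by
    have h : IsLocalization (⊥ : Ideal B).primeCompl (Localization.AtPrime (⊥ : Ideal B)) :=
      inferInstance
    convert! h
    ext; simp [Ideal.primeCompl]
  -- The local ring of `B` at its generic point is `k(p)`.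
  have : Algebra.IsSmoothAt k (⊥ : Ideal B) :=
    .of_equiv ((IsLocalization.algEquiv (nonZeroDivisors B) p.ResidueField
      (Localization.AtPrime (⊥ : Ideal B))).restrictScalars k)
  obtain ⟨f, hf, n, _, _, _⟩ :=
    Algebra.IsSmoothAt.exists_isStandardEtale_mvPolynomial (R := k) (p := (⊥ : Ideal B))
  have hnil : ¬ IsNilpotent (algebraMap B (Localization.Away f) (Ideal.Quotient.mk p a)) := by
    have hinj := IsLocalization.injective (Localization.Away f)
      (powers_le_nonZeroDivisors_of_noZeroDivisors hf)
    rwa [IsNilpotent.map_iff hinj, isNilpotent_iff_eq_zero, Ideal.Quotient.eq_zero_iff_mem]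
  obtain ⟨q, hq, _⟩ := exists_mem_specmSep_of_etale (k := k) (n := n) _ hnil
  have hφ (x : A) : algebraMap (Localization.Away f) q.asIdeal.ResidueField
      (algebraMap B (Localization.Away f) (Ideal.Quotient.mk p x)) = 0 ↔
      algebraMap B (Localization.Away f) (Ideal.Quotient.mk p x) ∈ q.asIdeal :=
    Ideal.algebraMap_residueField_eq_zero
  let φ : A →ₐ[k] q.asIdeal.ResidueField := (IsScalarTower.toAlgHom k _ _).comp
    ((IsScalarTower.toAlgHom k B (Localization.Away f)).comp (Ideal.Quotient.mkₐ k p))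
  refine ⟨_, ker_mem_specmSep φ, fun x hx => ?_, ?_⟩
  · have : Ideal.Quotient.mk p x = 0 := Ideal.Quotient.eq_zero_iff_mem.2 hx
    exact (hφ x).2 (by simp [this])
  · exact fun h => hq ((hφ a).1 h)

theorem mainTheorem3 {k : Type*} [Field k] (kbar : Type*) [Field kbar] [Algebra k kbar]
    [IsAlgClosure k kbar] (n : ℕ) (p : Ideal (MvPolynomial (Fin n) k)) [p.IsPrime] :
    List.TFAE [
      Algebra.FormallySmooth k p.ResidueField,
      ∃ (r : ℕ) (d : Fin r → Derivation k (MvPolynomial (Fin n) k) (MvPolynomial (Fin n) k))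
        (g : Fin r → MvPolynomial (Fin n) k),
        p.map (algebraMap (MvPolynomial (Fin n) k) (Localization.AtPrime p)) =
          Ideal.span (Set.range fun i =>
            algebraMap (MvPolynomial (Fin n) k) (Localization.AtPrime p) (g i)) ∧
        (Matrix.of fun i j => d i (g j)).det ∉ p,
      SeparablyGenerated k p.ResidueField,
      IsReduced (p.ResidueField ⊗[k] kbar),
      Dense {x : PrimeSpectrum.zeroLocus (p : Set (MvPolynomial (Fin n) k)) |
        (x : PrimeSpectrum (MvPolynomial (Fin n) k)) ∈ specmSep k (MvPolynomial (Fin n) k)},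
      p = ⨅ m ∈ specmSep k (MvPolynomial (Fin n) k) ∩
        PrimeSpectrum.zeroLocus (p : Set (MvPolynomial (Fin n) k)), m.asIdeal] := by
  have hess : Algebra.EssFiniteType k p.ResidueField := .comp k (MvPolynomial (Fin n) k) _
  have : IsAlgClosed kbar := IsAlgClosure.isAlgClosed k
  tfae_have 1 → 2 := fun _ => exists_det_notMem_of_formallySmooth p
  tfae_have 2 → 1 := fun ⟨_, d, g, hg, hdet⟩ =>
    formallySmooth_residueField_of_det_notMem p d g hg hdet
  tfae_have 3 → 1 := SeparablyGenerated.formallySmooth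
  tfae_have 4 → 3 := fun _ => separablyGenerated_of_isReduced_tensorProduct kbar
  tfae_have 5 ↔ 6 := dense_iff_eq_iInf p _
  tfae_have 1 → 6 := fun _ => by
    refine le_antisymm (le_iInf₂ fun m hm => hm.2) fun a ha => ?_
    by_contra hap
    obtain ⟨m, hm, hpm, ham⟩ := exists_mem_specmSep_notMem (k := k) p hap
    exact ham ((Submodule.mem_iInf _).1 ((Submodule.mem_iInf _).1 ha m) ⟨hm, hpm⟩)
  tfae_have 6 → 4 := fun h => by
    rw [iInf_subtype'] at h
    have (m : ↥(specmSep k (MvPolynomial (Fin n) k) ∩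
        PrimeSpectrum.zeroLocus (p : Set (MvPolynomial (Fin n) k)))) :
        Algebra.IsSeparable k m.1.asIdeal.ResidueField := m.2.1.2
    exact isReduced_residueField_tensorProduct kbar p _ h
  tfae_finish
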